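/- Let $n\ge 1$, let $\Omega\subset\mathbb R^n$ be a bounded domain (nonempty, open, connected), let $\epsilon>0$, and let $\alpha\ge 0$, $\beta>0$ with $\alpha+\beta=1$ (for instance $\alpha=\frac{p-1}{p+n}$, $\beta=\frac{n+1}{p+n}$ with $1<p<\infty$); if $n=1$, assume moreover $\alpha>0$. Put $$O_\epsilon=\{x\in\mathbb R^n\setminus\Omega:\operatorname{dist}(x,\partial\Omega)\le\epsilon\},\quad I_\epsilon=\{x\in\Omega:\operatorname{dist}(x,\partial\Omega)\le\epsilon\},\quad \Omega_\epsilon=\Omega\cup O_\epsilon,\quad \Gamma_\epsilon=\{x\in\Omega_\epsilon:\operatorname{dist}(x,\partial\Omega)\le\epsilon\}.$$ Let $\delta:\Omega_\epsilon\to[0,1]$ be $0$ on $\Omega\setminus I_\epsilon$, $1-\epsilon^{-1}\operatorname{dist}(x,\partial\Omega)$ on $I_\epsilon$, and $1$ on $O_\epsilon$. Let $F:\Gamma_\epsilon\to\mathbb R$ be Lipschitz continuous. For $v\in\partial B_\epsilon=\{v\in\mathbb R^n:|v|=\epsilon\}$ let $\mu_v$ be the uniform $(n-1)$-dimensional probability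 measure on the closed disk $\{z\in\mathbb R^n:\langle z,v\rangle=0,\ |z|\le\epsilon\}$. For $x\in\Omega_\epsilon$ define $$Iu(x)=\frac{1-\delta(x)}2\Big[\sup_{v\in\partial B_\epsilon}\Big(\alpha u(x+v)+\beta\int u(x+z)\,d\mu_v(z)\Big)+\inf_{v\in\partial B_\epsilon}\Big(\alpha u(x+v)+\beta\int u(x+z)\,d\mu_v(z)\Big)\Big]+\delta(x)F(x),$$ where $Iu(x)=F(x)$ for $x\in O_\epsilon$ and the term $\delta(x)F(x)$ is read as $0$ where $\delta(x)=0$. A solution of the dynamic programming principle (DPP) is a bounded Borel measurable function $u:\Omega_\epsilon\to\mathbb R$ with $u=Iu$ on $\Omega_\epsilon$. Then the pointwise limits $\underline u=\lim_{k\to\infty}I^k(\inf_{\Gamma_\epsilon} F)$ and $\overline u=\lim_{k\to\infty}I^k(\sup_{\Gamma_\epsilon} F)$ (iterates starting from constant functions) exist on $\Omega_\epsilon$; $\underline u$ is lower semicontinuous, $\overline u$ is upper semicontinuous, both are solutions of the DPP, and $\underline u=\overline u$. Every solution $u$ of the DPP coincides with $\underline u=\overline u$ on $\Omega_\epsilon$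 (so the solution is unique), and it is continuous on $\Omega_\epsilon$. -/

import Mathlib

open MeasureTheory Filter Topology Set

noncomputable section

namespace TugOfWar

/-- The outside boundary strip `O_ε`: points outside `Ω` at distance at most `ε` from `∂Ω`. -/
def outerStrip {n : ℕ} (Ω : Set (EuclideanSpace ℝ (Fin n))) (ε : ℝ) :
    Set (EuclideanSpace ℝ (Fin n)) :=
  {x | x ∉ Ω ∧ Metric.infDist x (frontier Ω) ≤ ε}

/-- The inside boundary strip `I_ε`: points of `Ω` at distance at most `ε` from `∂Ω`. -/
def innerStrip {n : ℕ} (Ω : Set (EuclideanSpace ℝ (Fin n))) (ε : ℝ) :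
    Set (EuclideanSpace ℝ (Fin n)) :=
  {x | x ∈ Ω ∧ Metric.infDist x (frontier Ω) ≤ ε}

/-- The thickened domain `Ω_ε = Ω ∪ O_ε`. -/
def thickenedDomain {n : ℕ} (Ω : Set (EuclideanSpace ℝ (Fin n))) (ε : ℝ) :
    Set (EuclideanSpace ℝ (Fin n)) :=
  Ω ∪ outerStrip Ω ε

/-- The boundary strip `Γ_ε`, on which the boundary data live. -/
def boundaryStrip {n : ℕ} (Ω : Set (EuclideanSpace ℝ (Fin n))) (ε : ℝ) :
    Set (EuclideanSpace ℝ (Fin n)) :=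
  {x | x ∈ thickenedDomain Ω ε ∧ Metric.infDist x (frontier Ω) ≤ ε}

open Classical in
/-- The boundary cutoff `δ`: it is `0` on `Ω ∖ I_ε`, `1 - ε⁻¹ dist(x, ∂Ω)` on `I_ε`, and `1`
on `O_ε`. (Its value outside `Ω_ε` is irrelevant.) -/
def cutoff {n : ℕ} (Ω : Set (EuclideanSpace ℝ (Fin n))) (ε : ℝ)
    (x : EuclideanSpace ℝ (Fin n)) : ℝ :=
  if x ∈ innerStrip Ω ε then 1 - ε⁻¹ * Metric.infDist x (frontier Ω)
  else if x ∈ Ω then 0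
  else 1

/-- Lebesgue measure on the hyperplane `v^⊥` (with its inherited inner product). The instance is
named explicitly, since the hyperplane is also a subtype of the ambient space. -/
def hyperplaneMeasure {n : ℕ} (v : EuclideanSpace ℝ (Fin n)) :
    Measure ((Submodule.span ℝ {v})ᗮ : Submodule ℝ (EuclideanSpace ℝ (Fin n))) :=
  (measureSpaceOfInnerProductSpace
    (E := ((Submodule.span ℝ {v})ᗮ : Submodule ℝ (EuclideanSpace ℝ (Fin n))))).volume

/-- `μ_v`: the uniform `(n-1)`-dimensional probability measure on the closed disk of radius `ε`,
centred at the origin, in the hyperplane orthogonal to `v`, as a measure on `ℝⁿ`. -/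
def diskMeasure {n : ℕ} (ε : ℝ) (v : EuclideanSpace ℝ (Fin n)) :
    Measure (EuclideanSpace ℝ (Fin n)) :=
  Measure.map (fun z : ((Submodule.span ℝ {v})ᗮ : Submodule ℝ (EuclideanSpace ℝ (Fin n))) =>
      (z : EuclideanSpace ℝ (Fin n)))
    (ProbabilityTheory.cond (hyperplaneMeasure v) (Metric.closedBall 0 ε))

/-- The quantity `α u(x+v) + β ∫ u(x+z) dμ_v(z)`. -/
def moveValue {n : ℕ} (ε α β : ℝ) (u : EuclideanSpace ℝ (Fin n) → ℝ)
    (x v : EuclideanSpace ℝ (Fin n)) : ℝ :=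
  α * u (x + v) + β * ∫ z, u (x + z) ∂(diskMeasure ε v)

/-- The boundary-corrected operator `I`, with supremum and infimum over `v ∈ ∂B_ε`. -/
def dppOperator {n : ℕ} (Ω : Set (EuclideanSpace ℝ (Fin n))) (ε α β : ℝ)
    (F u : EuclideanSpace ℝ (Fin n) → ℝ) (x : EuclideanSpace ℝ (Fin n)) : ℝ :=
  (1 - cutoff Ω ε x) / 2 *
      ((⨆ v : Metric.sphere (0 : EuclideanSpace ℝ (Fin n)) ε, moveValue ε α β u x v) +
        (⨅ v : Metric.sphere (0 : EuclideanSpace ℝ (Fin n)) ε, moveValue ε α β u x v)) +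
    cutoff Ω ε x * F x

/-- `u` is a (bounded Borel) measurable function on `Ω_ε` satisfying the dynamic programming
principle `u = I u` at every point of `Ω_ε`. Only the values of `u` on `Ω_ε` matter. -/
structure IsMeasurableSolution {n : ℕ} (Ω : Set (EuclideanSpace ℝ (Fin n))) (ε α β : ℝ)
    (F u : EuclideanSpace ℝ (Fin n) → ℝ) : Prop where
  measurable : Measurable (fun x : thickenedDomain Ω ε => u x)
  bounded : ∃ C : ℝ, ∀ x ∈ thickenedDomain Ω ε, |u x| ≤ C
  dpp : ∀ x ∈ thickenedDomain Ω ε, u x = dppOperator Ω ε α β F u x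

/-- `w` is, on `Ω_ε`, the pointwise limit of the iterates `I^k c` of the constant function `c`. -/
def IsIterationLimit {n : ℕ} (Ω : Set (EuclideanSpace ℝ (Fin n))) (ε α β : ℝ)
    (F : EuclideanSpace ℝ (Fin n) → ℝ) (c : ℝ) (w : EuclideanSpace ℝ (Fin n) → ℝ) : Prop :=
  ∀ x ∈ thickenedDomain Ω ε,
    Tendsto (fun k : ℕ => ((dppOperator Ω ε α β F)^[k] (fun _ => c)) x) atTop (𝓝 (w x))

end TugOfWar

end

/-! ### Geometry of the strips and continuity of the cutoff. -/

namespace TugOfWar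

variable {n : ℕ} {Ω : Set (EuclideanSpace ℝ (Fin n))} {ε : ℝ}

/-! The operator is a strict contraction in a weighted sup norm on the compact set `thickenedDomain
Ω ε`, so everything follows from a Banach fixed-point argument. The weight is `g x = C - exp (s *
‖x‖ ^ 2)`. The exponential is strictly convex and the moves are symmetric on average, so a move
raises its mean by a definite amount once `s` is large, and the expected weight drops by at least 1.
As `1 ≤ g ≤ C`, this drop is at least the fraction `C⁻¹` of `g` (`exists_contraction_weight`). For
`n ≥ 2` the gain comes from the disk average, for every direction `v`, so it survives both supremum
and infimum; it needs only `β > 0`. For `n = 1` the disk is a point, but the sphere is `{v, -v}`,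
supremum plus infimum is a plain sum, and the gain comes from the pair `x ± v`; this is where `α >
0` enters. The operator preserves continuity on the compact domain (`continuousOn_dppOperator`), so
iterates of a constant converge uniformly to a continuous fixed point (`ContractsOn.exists_fixed`).
Contraction also holds between bounded Borel functions, which gives uniqueness among all solutions
(`ContractsOn.eqOn_of_fixed`). -/

lemma infDist_frontier_le {x y : EuclideanSpace ℝ (Fin n)} (hx : x ∈ Ω) (hy : y ∉ Ω) :
    Metric.infDist y (frontier Ω) ≤ dist y x := by
  -- The distance from `y` to `Ω` is attained at a frontier point.
  obtain ⟨p, hp, hpy⟩ := exists_mem_frontier_infDist_compl_eq_dist (s := Ωᶜ) (x := y) hy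
    (fun h => by simpa using (h ▸ mem_univ x : x ∈ Ωᶜ) hx)
  rw [frontier_compl] at hp
  rw [compl_compl] at hpy
  calc Metric.infDist y (frontier Ω) ≤ dist y p := Metric.infDist_le_dist_of_mem hp
    _ = Metric.infDist y Ω := hpy.symm
    _ ≤ dist y x := Metric.infDist_le_dist_of_mem hx

lemma add_mem_thickenedDomain {x z : EuclideanSpace ℝ (Fin n)} (hx : x ∈ Ω) (hz : ‖z‖ ≤ ε) :
    x + z ∈ thickenedDomain Ω ε := by
  by_cases h : x + z ∈ Ω
  · exact Or.inl h
  · exact Or.inr ⟨h, (infDist_frontier_le hx h).trans (by simpa [dist_eq_norm] using hz)⟩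

lemma isClosed_thickenedDomain (hε : 0 ≤ ε) : IsClosed (thickenedDomain Ω ε) := by
  have : thickenedDomain Ω ε = closure Ω ∪ {x | Metric.infDist x (frontier Ω) ≤ ε} := by
    ext x
    constructor
    · rintro (h | h)
      · exact Or.inl (subset_closure h)
      · exact Or.inr h.2
    · intro h
      by_cases hx : x ∈ Ω
      · exact Or.inl hx
      · refine Or.inr ⟨hx, ?_⟩
        rcases h with h | h
        · rw [Metric.infDist_zero_of_mem]
          · exact hε
          · exact ⟨h, fun h' => hx (interior_subset h')⟩
        · exact h
  rw [this]
  exact isClosed_closure.union (isClosed_le (Metric.continuous_infDist_pt _) continuous_const)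

lemma frontier_nonempty_of_isBounded (hn : 1 ≤ n) (hΩ : Ω.Nonempty)
    (hΩb : Bornology.IsBounded Ω) : (frontier Ω).Nonempty := by
  have : Nonempty (Fin n) := ⟨⟨0, hn⟩⟩
  refine nonempty_frontier_iff.2 ⟨hΩ, fun h => ?_⟩
  rw [h] at hΩb
  exact NormedSpace.unbounded_univ ℝ (EuclideanSpace ℝ (Fin n)) hΩb

lemma isCompact_thickenedDomain (hε : 0 ≤ ε) (hfr : (frontier Ω).Nonempty)
    (hΩb : Bornology.IsBounded Ω) : IsCompact (thickenedDomain Ω ε) := by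
  refine Metric.isCompact_of_isClosed_isBounded (isClosed_thickenedDomain hε) ?_
  refine hΩb.union ?_
  have hb : Bornology.IsBounded (Metric.thickening (ε + 1) (frontier Ω)) :=
    (hΩb.closure.subset frontier_subset_closure).thickening
  refine hb.subset fun x hx => ?_
  rw [Metric.mem_thickening_iff]
  exact (Metric.infDist_lt_iff hfr).1 (hx.2.trans_lt (lt_add_one ε))

lemma cutoff_of_notMem {x : EuclideanSpace ℝ (Fin n)} (hx : x ∉ Ω) : cutoff Ω ε x = 1 := by
  simp [cutoff, innerStrip, hx]

/-- The minimum merges the inner strip and the rest of `Ω` into one expression that is visibly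
continuous. -/
lemma cutoff_of_mem (hε : 0 < ε) {x : EuclideanSpace ℝ (Fin n)} (hx : x ∈ Ω) :
    cutoff Ω ε x = 1 - min (ε⁻¹ * Metric.infDist x (frontier Ω)) 1 := by
  have h : ε⁻¹ * Metric.infDist x (frontier Ω) ≤ 1 ↔ Metric.infDist x (frontier Ω) ≤ ε := by
    rw [inv_mul_le_iff₀ hε, mul_one]
  by_cases hd : Metric.infDist x (frontier Ω) ≤ ε
  · simp [cutoff, innerStrip, hx, hd, min_eq_left (h.2 hd)]
  · simp [cutoff, innerStrip, hx, hd, min_eq_right (le_of_not_ge fun h' => hd (h.1 h'))]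

lemma cutoff_le_one (hε : 0 < ε) (x : EuclideanSpace ℝ (Fin n)) : cutoff Ω ε x ≤ 1 := by
  by_cases hx : x ∈ Ω
  · rw [cutoff_of_mem hε hx]
    have : 0 ≤ min (ε⁻¹ * Metric.infDist x (frontier Ω)) 1 :=
      le_min (mul_nonneg (inv_nonneg.2 hε.le) Metric.infDist_nonneg) zero_le_one
    linarith
  · exact (cutoff_of_notMem hx).le

lemma cutoff_nonneg (hε : 0 < ε) (x : EuclideanSpace ℝ (Fin n)) : 0 ≤ cutoff Ω ε x := by
  by_cases hx : x ∈ Ω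
  · rw [cutoff_of_mem hε hx]
    linarith [min_le_right (ε⁻¹ * Metric.infDist x (frontier Ω)) 1]
  · rw [cutoff_of_notMem hx]
    exact zero_le_one

lemma continuous_cutoff (hε : 0 < ε) : Continuous (cutoff Ω ε) := by
  classical
  have h : cutoff Ω ε = fun x => if x ∈ Ω then
      1 - min (ε⁻¹ * Metric.infDist x (frontier Ω)) 1 else 1 := by
    ext x
    by_cases hx : x ∈ Ω
    · simp only [hx, if_true, cutoff_of_mem hε hx]
    · simp only [hx, if_false, cutoff_of_notMem hx]
  rw [h]
  -- On the frontier the distance vanishes, so both branches equal 1.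
  refine Continuous.if (fun x hx => ?_) ?_ continuous_const
  · rw [Metric.infDist_zero_of_mem (s := frontier Ω) hx]
    simp
  · exact continuous_const.sub (((Metric.continuous_infDist_pt _).const_smul ε⁻¹).min
      continuous_const)

lemma mem_boundaryStrip_of_cutoff_ne_zero (hε : 0 < ε) {x : EuclideanSpace ℝ (Fin n)}
    (hx : x ∈ thickenedDomain Ω ε) (h : cutoff Ω ε x ≠ 0) : x ∈ boundaryStrip Ω ε := by
  refine ⟨hx, ?_⟩
  rcases hx with hx | hx
  · rw [cutoff_of_mem hε hx] at h
    by_contra! hd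
    refine h ?_
    rw [min_eq_right, sub_self]
    rw [le_inv_mul_iff₀ hε, mul_one]
    exact hd.le
  · exact hx.2

/-- A product `a * b` is continuous if `a` is, and `b` is bounded and continuous where `a` does
not vanish. -/
lemma continuousOn_mul_of_bounded {X : Type*} [TopologicalSpace X] {s : Set X} {a b : X → ℝ}
    (ha : Continuous a) (hb : ContinuousOn b {x ∈ s | a x ≠ 0}) {C : ℝ}
    (hC : ∀ x ∈ s, a x ≠ 0 → |b x| ≤ C) : ContinuousOn (fun x => a x * b x) s := by
  intro x hx
  by_cases h0 : a x = 0
  · have h1 : Tendsto (fun y => |a y| * C) (𝓝[s] x) (𝓝 0) := by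
      have : Tendsto (fun y => |a y| * C) (𝓝 x) (𝓝 (|a x| * C)) :=
        (ha.abs.mul continuous_const).tendsto x
      rw [h0, abs_zero, zero_mul] at this
      exact this.mono_left nhdsWithin_le_nhds
    rw [ContinuousWithinAt, h0, zero_mul]
    refine squeeze_zero_norm' ?_ h1
    filter_upwards [self_mem_nhdsWithin] with y hy
    rw [Real.norm_eq_abs, abs_mul]
    by_cases hy0 : a y = 0
    · simp [hy0]
    · exact mul_le_mul_of_nonneg_left (hC y hy hy0) (abs_nonneg _)
  · refine (ha.continuousWithinAt).mul ?_
    refine (hb x ⟨hx, h0⟩).mono_of_mem_nhdsWithin ?_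
    exact inter_mem self_mem_nhdsWithin
      (mem_nhdsWithin_of_mem_nhds (ha.continuousAt.eventually_ne h0))

end TugOfWar

/-! ### Moments of the uniform measure on a disk. -/

namespace TugOfWar

lemma isProbabilityMeasure_cond_closedBall {V : Type*} [NormedAddCommGroup V] [NormedSpace ℝ V]
    [FiniteDimensional ℝ V] [MeasurableSpace V] (μ : Measure V) [μ.IsAddHaarMeasure] {r : ℝ}
    (hr : 0 < r) :
    IsProbabilityMeasure (ProbabilityTheory.cond μ (Metric.closedBall 0 r)) :=
  ProbabilityTheory.cond_isProbabilityMeasure_of_finite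
    (Metric.measure_closedBall_pos μ 0 hr).ne' measure_closedBall_lt_top.ne

lemma ae_cond_closedBall {V : Type*} [NormedAddCommGroup V] [MeasurableSpace V] [BorelSpace V]
    (μ : Measure V) {r : ℝ} :
    ∀ᵐ z ∂(ProbabilityTheory.cond μ (Metric.closedBall (0 : V) r)), ‖z‖ ≤ r := by
  refine Measure.ae_smul_measure ?_ _
  filter_upwards [ae_restrict_mem Metric.isClosed_closedBall.measurableSet] with z hz
  simpa using hz

section Ball

variable {V : Type*} [NormedAddCommGroup V] [NormedSpace ℝ V] [FiniteDimensional ℝ V]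
  [MeasurableSpace V] [BorelSpace V] (μ : Measure V) [μ.IsAddHaarMeasure] {r : ℝ}

lemma map_neg_cond_closedBall :
    (ProbabilityTheory.cond μ (Metric.closedBall (0 : V) r)).map Neg.neg =
      ProbabilityTheory.cond μ (Metric.closedBall (0 : V) r) := by
  rw [ProbabilityTheory.cond, Measure.map_smul]
  congr 1
  have h : Neg.neg ⁻¹' (Metric.closedBall (0 : V) r) = Metric.closedBall (0 : V) r := by
    ext z; simp
  have h2 := Measure.restrict_map (μ := μ) measurable_neg
    (Metric.isClosed_closedBall (x := (0 : V)) (ε := r)).measurableSet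
  rw [h] at h2
  rw [← h2]
  congr 1
  exact Measure.map_neg_eq_self μ

/-- The ball of half the radius carries the fraction `2⁻ᵈ ≤ 1/2` of the mass, so at least half of
the mass has `‖z‖ ^ 2 ≥ r ^ 2 / 4`. -/
lemma le_integral_norm_sq_cond_closedBall (hr : 0 < r) (hd : 0 < Module.finrank ℝ V) :
    r ^ 2 / 8 ≤ ∫ z, ‖z‖ ^ 2 ∂(ProbabilityTheory.cond μ (Metric.closedBall (0 : V) r)) := by
  set ν := ProbabilityTheory.cond μ (Metric.closedBall (0 : V) r) with hν
  have := isProbabilityMeasure_cond_closedBall μ hr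
  have hlt : ν.real (Metric.closedBall (0 : V) (1 / 2 * r)) ≤ 1 / 2 := by
    have hsub : Metric.closedBall (0 : V) r ∩ Metric.closedBall 0 (1 / 2 * r) =
        Metric.closedBall 0 (1 / 2 * r) :=
      inter_eq_right.2 (Metric.closedBall_subset_closedBall (by linarith))
    rw [Measure.real, hν, ProbabilityTheory.cond_apply Metric.isClosed_closedBall.measurableSet,
      hsub, Measure.addHaar_closedBall_mul μ 0 (by norm_num) hr.le, mul_left_comm,
      ENNReal.inv_mul_cancel (Metric.measure_closedBall_pos μ 0 hr).ne'
      measure_closedBall_lt_top.ne, mul_one, ENNReal.toReal_ofReal (by positivity)]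
    exact pow_le_of_le_one (by norm_num) (by norm_num) hd.ne'
  have hge : 1 / 2 ≤ ν.real (Metric.closedBall (0 : V) (1 / 2 * r))ᶜ := by
    rw [probReal_compl_eq_one_sub Metric.isClosed_closedBall.measurableSet]
    linarith
  have hint : Integrable (fun z : V => ‖z‖ ^ 2) ν := by
    refine Integrable.of_bound (by fun_prop) (r ^ 2) ?_
    filter_upwards [ae_cond_closedBall μ] with z hz
    rw [Real.norm_of_nonneg (by positivity)]
    gcongr
  calc r ^ 2 / 8 = (r ^ 2 / 4) * (1 / 2) := by ring
    _ ≤ (r ^ 2 / 4) * ν.real (Metric.closedBall (0 : V) (1 / 2 * r))ᶜ := by gcongr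
    _ = ∫ z, (Metric.closedBall (0 : V) (1 / 2 * r))ᶜ.indicator (fun _ => r ^ 2 / 4) z ∂ν := by
      rw [integral_indicator_const _ Metric.isClosed_closedBall.measurableSet.compl, smul_eq_mul,
        mul_comm]
    _ ≤ ∫ z, ‖z‖ ^ 2 ∂ν := by
      refine integral_mono
        ((integrable_const _).indicator Metric.isClosed_closedBall.measurableSet.compl) hint ?_
      refine indicator_le' (fun z hz => ?_) (fun z _ => by positivity)
      have hz' : 1 / 2 * r < ‖z‖ := by simpa using hz
      nlinarith

end Ball

variable {n : ℕ} {ε : ℝ} (v : EuclideanSpace ℝ (Fin n))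

instance isAddHaarMeasure_hyperplaneMeasure : (hyperplaneMeasure v).IsAddHaarMeasure := by
  unfold hyperplaneMeasure
  infer_instance

lemma isProbabilityMeasure_diskMeasure (hε : 0 < ε) :
    IsProbabilityMeasure (diskMeasure ε v) := by
  have := isProbabilityMeasure_cond_closedBall (hyperplaneMeasure v) hε
  exact Measure.isProbabilityMeasure_map measurable_subtype_coe.aemeasurable

lemma ae_diskMeasure : ∀ᵐ z ∂(diskMeasure ε v), ‖z‖ ≤ ε := by
  rw [diskMeasure, ae_map_iff measurable_subtype_coe.aemeasurable
    (measurableSet_le measurable_norm measurable_const)]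
  exact ae_cond_closedBall (hyperplaneMeasure v)

lemma integral_diskMeasure (f : EuclideanSpace ℝ (Fin n) → ℝ) (hf : Continuous f) :
    ∫ z, f z ∂(diskMeasure ε v) = ∫ z, f z ∂(ProbabilityTheory.cond (hyperplaneMeasure v)
      (Metric.closedBall 0 ε)) :=
  integral_map measurable_subtype_coe.aemeasurable hf.aestronglyMeasurable

/-- The disk is symmetric under `z ↦ -z` and the integrand is odd. -/
lemma integral_diskMeasure_inner (x : EuclideanSpace ℝ (Fin n)) :
    ∫ z, inner ℝ x z ∂(diskMeasure ε v) = 0 := by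
  rw [integral_diskMeasure v _ (by fun_prop)]
  set ν := ProbabilityTheory.cond (hyperplaneMeasure v) (Metric.closedBall 0 ε) with hν
  have h : ∫ z, inner ℝ x (z : EuclideanSpace ℝ (Fin n)) ∂ν =
      ∫ z, inner ℝ x ((-z : _) : EuclideanSpace ℝ (Fin n)) ∂ν := by
    conv_lhs => rw [hν, ← map_neg_cond_closedBall (hyperplaneMeasure v), ← hν]
    rw [integral_map measurable_neg.aemeasurable
      (Continuous.aestronglyMeasurable (by fun_prop))]
  have h2 : ∫ z, inner ℝ x ((-z : _) : EuclideanSpace ℝ (Fin n)) ∂ν =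
      - ∫ z, inner ℝ x (z : EuclideanSpace ℝ (Fin n)) ∂ν := by
    simp only [Submodule.coe_neg, inner_neg_right, integral_neg]
  linarith

lemma le_integral_diskMeasure_norm_sq (hn : 2 ≤ n) (hε : 0 < ε) (hv : v ≠ 0) :
    ε ^ 2 / 8 ≤ ∫ z, ‖z‖ ^ 2 ∂(diskMeasure ε v) := by
  rw [integral_diskMeasure v _ (by fun_prop)]
  refine le_integral_norm_sq_cond_closedBall (hyperplaneMeasure v) hε ?_
  have h1 := Submodule.finrank_add_finrank_orthogonal (Submodule.span ℝ {v})
  rw [finrank_euclideanSpace_fin, finrank_span_singleton hv] at h1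
  omega

lemma ae_diskMeasure_eq_zero (v : EuclideanSpace ℝ (Fin 1)) (hv : v ≠ 0) :
    ∀ᵐ z ∂(diskMeasure ε v), z = 0 := by
  rw [diskMeasure, ae_map_iff measurable_subtype_coe.aemeasurable
    (p := fun z => z = 0) (measurableSet_singleton 0)]
  refine ae_of_all _ fun z => ?_
  have h1 := Submodule.finrank_add_finrank_orthogonal (Submodule.span ℝ {v})
  rw [finrank_euclideanSpace_fin, finrank_span_singleton hv] at h1
  have h2 : (Submodule.span ℝ {v})ᗮ = ⊥ := Submodule.finrank_eq_zero.1 (by omega)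
  exact (Submodule.mem_bot ℝ).1 (h2.le z.2)

end TugOfWar

/-! ### Comparison estimates for the sum of supremum and infimum. -/

namespace TugOfWar

section Extrema

variable {ι : Type*} [Nonempty ι] {A B : ι → ℝ} {c : ℝ}

lemma ciSup_sub_ciSup_le (hB : BddAbove (range B)) (h : ∀ i, A i - B i ≤ c) :
    (⨆ i, A i) - ⨆ i, B i ≤ c := by
  rw [sub_le_iff_le_add]
  exact ciSup_le fun i => by linarith [h i, le_ciSup hB i]

lemma ciInf_sub_ciInf_le (hA : BddBelow (range A)) (h : ∀ i, A i - B i ≤ c) :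
    (⨅ i, A i) - ⨅ i, B i ≤ c := by
  rw [sub_le_comm]
  exact le_ciInf fun i => by linarith [h i, ciInf_le hA i]

end Extrema

variable {n : ℕ} {Ω X : Set (EuclideanSpace ℝ (Fin n))} {ε α β : ℝ}
  {u w f : EuclideanSpace ℝ (Fin n) → ℝ} {x y v : EuclideanSpace ℝ (Fin n)}

/-- `u` is bounded and Borel measurable on `X`. -/
structure BoundedMeasurableOn (X : Set (EuclideanSpace ℝ (Fin n)))
    (u : EuclideanSpace ℝ (Fin n) → ℝ) : Prop where
  measurable : Measurable (fun x : X => u x)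
  bounded : ∃ C : ℝ, ∀ x ∈ X, |u x| ≤ C

lemma BoundedMeasurableOn.of_continuousOn (hX : IsCompact X) (hu : ContinuousOn u X) :
    BoundedMeasurableOn X u :=
  ⟨hu.domRestrict.measurable, hX.exists_bound_of_continuousOn hu⟩

lemma BoundedMeasurableOn.integrable (hX : MeasurableSet X) (hε : 0 < ε)
    (hu : BoundedMeasurableOn X u) (hx : ∀ z, ‖z‖ ≤ ε → x + z ∈ X) :
    Integrable (fun z => u (x + z)) (diskMeasure ε v) := by
  have := isProbabilityMeasure_diskMeasure v hε
  obtain ⟨C, hC⟩ := hu.bounded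
  -- Since `u` is measurable only on `X`, it is extended by zero; the disk measure does not see the
  -- change.
  have hm : Measurable (X.indicator u) := by
    refine measurable_of_restrict_of_restrict_compl hX ?_ ?_
    · have : X.domRestrict (X.indicator u) = fun z : X => u z :=
        funext fun z => indicator_of_mem z.2 u
      rw [this]
      exact hu.measurable
    · have : Xᶜ.domRestrict (X.indicator u) = fun _ => 0 :=
        funext fun z => indicator_of_notMem z.2 u
      rw [this]
      exact measurable_const
  have hi : Integrable (fun z => X.indicator u (x + z)) (diskMeasure ε v) := by
    refine Integrable.of_bound (hm.comp (measurable_const_add x)).aestronglyMeasurable C ?_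
    filter_upwards [ae_diskMeasure v] with z hz
    rw [indicator_of_mem (hx z hz)]
    exact hC _ (hx z hz)
  refine hi.congr ?_
  filter_upwards [ae_diskMeasure v] with z hz
  rw [indicator_of_mem (hx z hz)]

lemma integrable_diskMeasure_of_continuous (hε : 0 < ε) (hf : Continuous f) :
    Integrable f (diskMeasure ε v) := by
  have h := (BoundedMeasurableOn.of_continuousOn (isCompact_closedBall 0 ε)
    hf.continuousOn).integrable (x := 0) (v := v)
      Metric.isClosed_closedBall.measurableSet hε (by simp)
  simpa using h

/-- Two functions and two base points are allowed so that the estimate serves both contraction (`x =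
y`) and continuity (`u = w`). -/
lemma moveValue_sub_le (hα : 0 ≤ α) (hβ : 0 ≤ β) (hv : ‖v‖ = ε)
    (hu : Integrable (fun z => u (x + z)) (diskMeasure ε v))
    (hw : Integrable (fun z => w (y + z)) (diskMeasure ε v))
    (hf : Integrable f (diskMeasure ε v))
    (h : ∀ z, ‖z‖ ≤ ε → u (x + z) - w (y + z) ≤ f z) :
    moveValue ε α β u x v - moveValue ε α β w y v ≤ α * f v + β * ∫ z, f z ∂(diskMeasure ε v) := by
  have h1 : ∫ z, u (x + z) ∂(diskMeasure ε v) - ∫ z, w (y + z) ∂(diskMeasure ε v) ≤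
      ∫ z, f z ∂(diskMeasure ε v) := by
    rw [← integral_sub hu hw]
    refine integral_mono_ae (hu.sub hw) hf ?_
    filter_upwards [ae_diskMeasure v] with z hz using h z hz
  have h2 := mul_le_mul_of_nonneg_left h1 hβ
  have h3 := mul_le_mul_of_nonneg_left (h v hv.le) hα
  simp only [moveValue]
  linarith

lemma moveValue_sub_le_const (hα : 0 ≤ α) (hβ : 0 ≤ β) (hαβ : α + β = 1) (hε : 0 < ε)
    (hv : ‖v‖ = ε)
    (hu : Integrable (fun z => u (x + z)) (diskMeasure ε v))
    (hw : Integrable (fun z => w (y + z)) (diskMeasure ε v)) {c : ℝ}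
    (h : ∀ z, ‖z‖ ≤ ε → u (x + z) - w (y + z) ≤ c) :
    moveValue ε α β u x v - moveValue ε α β w y v ≤ c := by
  have := isProbabilityMeasure_diskMeasure v hε
  refine (moveValue_sub_le hα hβ hv hu hw (integrable_const c) h).trans_eq ?_
  rw [integral_const, probReal_univ, one_smul, ← add_mul, hαβ, one_mul]

/-- Sum of the supremum and the infimum in the dynamic programming principle. -/
noncomputable def extremalSum (ε α β : ℝ) (u : EuclideanSpace ℝ (Fin n) → ℝ)
    (x : EuclideanSpace ℝ (Fin n)) : ℝ :=
  (⨆ v : Metric.sphere (0 : EuclideanSpace ℝ (Fin n)) ε, moveValue ε α β u x v) +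
    ⨅ v : Metric.sphere (0 : EuclideanSpace ℝ (Fin n)) ε, moveValue ε α β u x v

/-- The standing assumptions on the weights and the step size. -/
structure Admissible (ε α β : ℝ) : Prop where
  step_pos : 0 < ε
  fst_nonneg : 0 ≤ α
  snd_pos : 0 < β
  add_eq_one : α + β = 1

variable (hp : Admissible ε α β)
include hp

lemma abs_moveValue_le (hX : MeasurableSet X) (hu : BoundedMeasurableOn X u)
    (hx : ∀ z, ‖z‖ ≤ ε → x + z ∈ X) {C : ℝ} (hC : ∀ y ∈ X, |u y| ≤ C) (hv : ‖v‖ = ε) :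
    |moveValue ε α β u x v| ≤ C := by
  have hi := hu.integrable (v := v) hX hp.step_pos hx
  have h0 : moveValue ε α β (fun _ : EuclideanSpace ℝ (Fin n) => 0) x v = 0 := by
    simp [moveValue]
  have h1 := moveValue_sub_le_const (w := fun _ => 0) (y := x) hp.fst_nonneg hp.snd_pos.le
    hp.add_eq_one hp.step_pos hv hi (integrable_zero _ _ _) (c := C)
    fun z hz => by linarith [(abs_le.1 (hC _ (hx z hz))).2]
  have h2 := moveValue_sub_le_const (u := fun _ => 0) (x := x) hp.fst_nonneg hp.snd_pos.le
    hp.add_eq_one hp.step_pos hv (integrable_zero _ _ _) hi (c := C)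
    fun z hz => by linarith [(abs_le.1 (hC _ (hx z hz))).1]
  rw [h0] at h1 h2
  exact abs_le.2 ⟨by linarith, by linarith⟩

lemma bddAbove_range_moveValue (hX : MeasurableSet X) (hu : BoundedMeasurableOn X u)
    (hx : ∀ z, ‖z‖ ≤ ε → x + z ∈ X) :
    BddAbove (range fun v : Metric.sphere (0 : EuclideanSpace ℝ (Fin n)) ε =>
      moveValue ε α β u x v) := by
  obtain ⟨C, hC⟩ := hu.bounded
  refine ⟨C, ?_⟩
  rintro _ ⟨v, rfl⟩
  exact (abs_le.1 (abs_moveValue_le hp hX hu hx hC (mem_sphere_zero_iff_norm.1 v.2))).2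

lemma bddBelow_range_moveValue (hX : MeasurableSet X) (hu : BoundedMeasurableOn X u)
    (hx : ∀ z, ‖z‖ ≤ ε → x + z ∈ X) :
    BddBelow (range fun v : Metric.sphere (0 : EuclideanSpace ℝ (Fin n)) ε =>
      moveValue ε α β u x v) := by
  obtain ⟨C, hC⟩ := hu.bounded
  refine ⟨-C, ?_⟩
  rintro _ ⟨v, rfl⟩
  exact (abs_le.1 (abs_moveValue_le hp hX hu hx hC (mem_sphere_zero_iff_norm.1 v.2))).1

lemma extremalSum_sub_le (hX : MeasurableSet X) (hu : BoundedMeasurableOn X u)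
    (hw : BoundedMeasurableOn X w) (hx : ∀ z, ‖z‖ ≤ ε → x + z ∈ X)
    (hy : ∀ z, ‖z‖ ≤ ε → y + z ∈ X)
    (hne : (Metric.sphere (0 : EuclideanSpace ℝ (Fin n)) ε).Nonempty) {c : ℝ}
    (h : ∀ v, ‖v‖ = ε → moveValue ε α β u x v - moveValue ε α β w y v ≤ c) :
    extremalSum ε α β u x - extremalSum ε α β w y ≤ 2 * c := by
  have : Nonempty (Metric.sphere (0 : EuclideanSpace ℝ (Fin n)) ε) := hne.to_subtype
  have h1 := ciSup_sub_ciSup_le (bddAbove_range_moveValue hp hX hw hy)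
    fun v => h v (mem_sphere_zero_iff_norm.1 v.2)
  have h2 := ciInf_sub_ciInf_le (bddBelow_range_moveValue hp hX hu hx)
    fun v => h v (mem_sphere_zero_iff_norm.1 v.2)
  simp only [extremalSum]
  linarith

omit hp in
lemma sphere_nonempty (hn : 1 ≤ n) (hε : 0 ≤ ε) :
    (Metric.sphere (0 : EuclideanSpace ℝ (Fin n)) ε).Nonempty :=
  ⟨EuclideanSpace.single ⟨0, hn⟩ ε, by simp [abs_of_nonneg hε]⟩

lemma abs_extremalSum_le (hX : MeasurableSet X) (hu : BoundedMeasurableOn X u)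
    (hx : ∀ z, ‖z‖ ≤ ε → x + z ∈ X)
    (hne : (Metric.sphere (0 : EuclideanSpace ℝ (Fin n)) ε).Nonempty)
    {C : ℝ} (hC : ∀ y ∈ X, |u y| ≤ C) : |extremalSum ε α β u x| ≤ 2 * C := by
  have : Nonempty (Metric.sphere (0 : EuclideanSpace ℝ (Fin n)) ε) := hne.to_subtype
  have h0 : extremalSum ε α β (fun _ : EuclideanSpace ℝ (Fin n) => 0) x = 0 := by
    simp [extremalSum, moveValue]
  have h00 : BoundedMeasurableOn X (fun _ => 0) := ⟨measurable_const, 0, by simp⟩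
  have hb := fun v hv => abs_le.1 (abs_moveValue_le (v := v) hp hX hu hx hC hv)
  have hm : ∀ v, moveValue ε α β (fun _ : EuclideanSpace ℝ (Fin n) => 0) x v = 0 := by
    simp [moveValue]
  have h1 := extremalSum_sub_le hp hX hu h00 hx hx hne (c := C) fun v hv => by
    rw [hm]; linarith [(hb v hv).2]
  have h2 := extremalSum_sub_le hp hX h00 hu hx hx hne (c := C) fun v hv => by
    rw [hm]; linarith [(hb v hv).1]
  exact abs_le.2 ⟨by linarith, by linarith⟩

/-- The same `v` is played from both base points, so uniform continuity of `u` on `X` suffices and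
no regularity in `v` is needed. -/
lemma continuousOn_extremalSum (hX : IsCompact X) (hu : ContinuousOn u X)
    (hΩ : ∀ x ∈ Ω, ∀ z, ‖z‖ ≤ ε → x + z ∈ X)
    (hne : (Metric.sphere (0 : EuclideanSpace ℝ (Fin n)) ε).Nonempty) :
    ContinuousOn (extremalSum ε α β u) Ω := by
  have hm := BoundedMeasurableOn.of_continuousOn hX hu
  have huc := Metric.uniformContinuousOn_iff.1 (hX.uniformContinuousOn_of_continuous hu)
  have key : ∀ η, ∀ x ∈ Ω, ∀ y ∈ Ω, (∀ z, ‖z‖ ≤ ε → u (x + z) - u (y + z) ≤ η) →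
      extremalSum ε α β u x - extremalSum ε α β u y ≤ 2 * η := fun η x hx y hy h =>
    extremalSum_sub_le hp hX.measurableSet hm hm (hΩ x hx) (hΩ y hy) hne fun v hv =>
      moveValue_sub_le_const hp.fst_nonneg hp.snd_pos.le hp.add_eq_one hp.step_pos hv
        (hm.integrable hX.measurableSet hp.step_pos (hΩ x hx))
        (hm.integrable hX.measurableSet hp.step_pos (hΩ y hy)) h
  refine Metric.continuousOn_iff.2 fun x hx η hη => ?_
  obtain ⟨r, hr, H⟩ := huc (η / 4) (by positivity)
  refine ⟨r, hr, fun y hy hyx => ?_⟩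
  have hd : ∀ z, ‖z‖ ≤ ε → |u (y + z) - u (x + z)| < η / 4 := fun z hz =>
    H _ (hΩ y hy z hz) _ (hΩ x hx z hz) (by simpa using hyx)
  have h1 := key (η / 4) y hy x hx fun z hz => (abs_lt.1 (hd z hz)).2.le
  have h2 := key (η / 4) x hx y hy fun z hz => by linarith [(abs_lt.1 (hd z hz)).1]
  rw [Real.dist_eq, abs_lt]
  constructor <;> linarith

end TugOfWar

/-! ### The contraction weight. -/

namespace TugOfWar

variable {n : ℕ} {Ω X : Set (EuclideanSpace ℝ (Fin n))} {ε α β : ℝ}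
  {u w F : EuclideanSpace ℝ (Fin n) → ℝ} {x v : EuclideanSpace ℝ (Fin n)}

/-- This is `1 + t ≤ exp t` applied to the increment of `s * ‖x‖ ^ 2`; the term linear in `z` will
cancel on averaging. -/
lemma one_add_mul_exp_le (s : ℝ) (x z : EuclideanSpace ℝ (Fin n)) :
    Real.exp (s * ‖x‖ ^ 2) * (1 + s * (2 * inner ℝ x z + ‖z‖ ^ 2)) ≤
      Real.exp (s * ‖x + z‖ ^ 2) := by
  have h : s * ‖x + z‖ ^ 2 = s * ‖x‖ ^ 2 + s * (2 * inner ℝ x z + ‖z‖ ^ 2) := by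
    rw [norm_add_sq_real]; ring
  rw [h, Real.exp_add]
  gcongr
  linarith [Real.add_one_le_exp (s * (2 * inner ℝ x z + ‖z‖ ^ 2))]

lemma one_add_mul_exp_le_integral (hn : 2 ≤ n) (hε : 0 < ε) (hv : v ≠ 0) {s : ℝ} (hs : 0 ≤ s)
    (x : EuclideanSpace ℝ (Fin n)) :
    Real.exp (s * ‖x‖ ^ 2) * (1 + s * (ε ^ 2 / 8)) ≤
      ∫ z, Real.exp (s * ‖x + z‖ ^ 2) ∂(diskMeasure ε v) := by
  have := isProbabilityMeasure_diskMeasure v hε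
  have hi1 : Integrable (fun z => 2 * inner ℝ x z) (diskMeasure ε v) :=
    integrable_diskMeasure_of_continuous hε (by fun_prop)
  have hi2 : Integrable (fun z => ‖z‖ ^ 2) (diskMeasure ε v) :=
    integrable_diskMeasure_of_continuous hε (by fun_prop)
  have hle := integral_mono (μ := diskMeasure ε v)
    (integrable_diskMeasure_of_continuous hε (by fun_prop))
    (integrable_diskMeasure_of_continuous hε (by fun_prop))
    fun z => one_add_mul_exp_le s x z
  refine le_trans ?_ hle
  have hi3 : Integrable (fun z => s * (2 * inner ℝ x z + ‖z‖ ^ 2)) (diskMeasure ε v) :=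
    integrable_diskMeasure_of_continuous hε (by fun_prop)
  rw [integral_const_mul, integral_add (integrable_const _) hi3, integral_const, probReal_univ,
    one_smul, integral_const_mul, integral_add hi1 hi2, integral_const_mul,
    integral_diskMeasure_inner, mul_zero, zero_add]
  gcongr
  exact le_integral_diskMeasure_norm_sq v hn hε hv

lemma eq_or_eq_neg_of_norm_eq {v w : EuclideanSpace ℝ (Fin 1)} (h : ‖w‖ = ‖v‖) :
    w = v ∨ w = -v := by
  rw [EuclideanSpace.norm_eq, EuclideanSpace.norm_eq] at h
  simp only [Finset.univ_unique, Fin.default_eq_zero, Finset.sum_singleton, Real.norm_eq_abs,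
    sq_abs, Real.sqrt_sq_eq_abs] at h
  rcases abs_eq_abs.1 h with h | h
  · left
    ext i
    rw [Subsingleton.elim i 0, h]
  · right
    ext i
    rw [Subsingleton.elim i 0, h, PiLp.neg_apply]

lemma extremalSum_eq_add_neg {u : EuclideanSpace ℝ (Fin 1) → ℝ} {x v : EuclideanSpace ℝ (Fin 1)}
    (hv : ‖v‖ = ε) :
    extremalSum ε α β u x = moveValue ε α β u x v + moveValue ε α β u x (-v) := by
  set f := moveValue ε α β u x
  have hmem : v ∈ Metric.sphere (0 : EuclideanSpace ℝ (Fin 1)) ε := by simpa using hv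
  have hmem' : -v ∈ Metric.sphere (0 : EuclideanSpace ℝ (Fin 1)) ε := by simpa using hv
  have : Nonempty (Metric.sphere (0 : EuclideanSpace ℝ (Fin 1)) ε) := ⟨⟨v, hmem⟩⟩
  have hall : ∀ w : Metric.sphere (0 : EuclideanSpace ℝ (Fin 1)) ε, f w = f v ∨ f w = f (-v) := by
    intro w
    rcases eq_or_eq_neg_of_norm_eq (v := v) (w := w)
      ((mem_sphere_zero_iff_norm.1 w.2).trans hv.symm) with h | h <;> simp [h]
  have hsup : (⨆ w : Metric.sphere (0 : EuclideanSpace ℝ (Fin 1)) ε, f w) =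
      max (f v) (f (-v)) := by
    have hb : BddAbove (range fun w : Metric.sphere (0 : EuclideanSpace ℝ (Fin 1)) ε => f w) := by
      refine ⟨max (f v) (f (-v)), ?_⟩
      rintro _ ⟨w, rfl⟩
      rcases hall w with h | h <;> simp [h]
    refine le_antisymm (ciSup_le fun w => ?_) (max_le (le_ciSup hb ⟨v, hmem⟩)
      (le_ciSup hb ⟨-v, hmem'⟩))
    rcases hall w with h | h <;> simp [h]
  have hinf : (⨅ w : Metric.sphere (0 : EuclideanSpace ℝ (Fin 1)) ε, f w) =
      min (f v) (f (-v)) := by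
    have hb : BddBelow (range fun w : Metric.sphere (0 : EuclideanSpace ℝ (Fin 1)) ε => f w) := by
      refine ⟨min (f v) (f (-v)), ?_⟩
      rintro _ ⟨w, rfl⟩
      rcases hall w with h | h <;> simp [h]
    refine le_antisymm (le_min (ciInf_le hb ⟨v, hmem⟩) (ciInf_le hb ⟨-v, hmem'⟩))
      (le_ciInf fun w => ?_)
    rcases hall w with h | h <;> simp [h]
  rw [extremalSum, hsup, hinf, max_add_min]

lemma moveValue_of_dim_one {u : EuclideanSpace ℝ (Fin 1) → ℝ} {x v : EuclideanSpace ℝ (Fin 1)}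
    (hε : 0 < ε) (hv : v ≠ 0) : moveValue ε α β u x v = α * u (x + v) + β * u x := by
  have := isProbabilityMeasure_diskMeasure v hε
  have h : ∫ z, u (x + z) ∂(diskMeasure ε v) = ∫ _, u x ∂(diskMeasure ε v) := by
    refine integral_congr_ae ?_
    filter_upwards [ae_diskMeasure_eq_zero v hv] with z hz
    rw [hz, add_zero]
  rw [moveValue, h, integral_const, probReal_univ, one_smul]

lemma exists_two_le_mul {a m : ℝ} (ha : 0 < a) (hm : 0 < m) :
    ∃ s : ℝ, 0 ≤ s ∧ 2 ≤ a * (1 + s * m) := by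
  refine ⟨2 / (a * m), by positivity, ?_⟩
  have : a * (1 + 2 / (a * m) * m) = a + 2 := by field_simp
  linarith

lemma extremalSum_contraction_dim_one {Ω X : Set (EuclideanSpace ℝ (Fin 1))}
    {u w : EuclideanSpace ℝ (Fin 1) → ℝ}
    (hp : Admissible ε α β) (hΩX : Ω ⊆ X)
    (hΩ : ∀ x ∈ Ω, ∀ z, ‖z‖ ≤ ε → x + z ∈ X) {s : ℝ} (hs : 0 ≤ s)
    (hs2 : 2 ≤ α * (1 + s * ε ^ 2)) {C M : ℝ} (hM : 0 ≤ M)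
    (h : ∀ y ∈ X, u y - w y ≤ M * (C - Real.exp (s * ‖y‖ ^ 2))) {x : EuclideanSpace ℝ (Fin 1)}
    (hx : x ∈ Ω) :
    extremalSum ε α β u x - extremalSum ε α β w x ≤
      2 * (M * (C - Real.exp (s * ‖x‖ ^ 2) - 1)) := by
  obtain ⟨v, hv⟩ := sphere_nonempty (n := 1) le_rfl hp.step_pos.le
  rw [mem_sphere_zero_iff_norm] at hv
  have hv0 : v ≠ 0 := norm_ne_zero_iff.1 (hv ▸ hp.step_pos.ne')
  have hα0 := hp.fst_nonneg
  have hβ0 := hp.snd_pos.le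
  have h1 := mul_le_mul_of_nonneg_left (h _ (hΩ x hx v hv.le)) hα0
  have h2 := mul_le_mul_of_nonneg_left (h _ (hΩ x hx (-v) (by rw [norm_neg, hv]))) hα0
  have h3 := mul_le_mul_of_nonneg_left (h _ (hΩX hx)) hβ0
  rw [extremalSum_eq_add_neg hv, extremalSum_eq_add_neg hv, moveValue_of_dim_one hp.step_pos hv0,
    moveValue_of_dim_one hp.step_pos hv0, moveValue_of_dim_one hp.step_pos (neg_ne_zero.2 hv0),
    moveValue_of_dim_one hp.step_pos (neg_ne_zero.2 hv0)]
  have e1 := one_add_mul_exp_le s x v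
  have e2 := one_add_mul_exp_le s x (-v)
  rw [inner_neg_right, norm_neg] at e2
  rw [hv] at e1 e2
  have e0 : 1 ≤ Real.exp (s * ‖x‖ ^ 2) := Real.one_le_exp (by positivity)
  set a := Real.exp (s * ‖x‖ ^ 2)
  set b := Real.exp (s * ‖x + v‖ ^ 2)
  set c := Real.exp (s * ‖x + -v‖ ^ 2)
  have e3 : 2 * a * (1 + s * ε ^ 2) ≤ b + c := by linarith
  -- Two moves, each gaining a factor 2. With `a ≥ 1` this leaves `2 * C - 4 * a ≤ 2 * (C - a - 1)`,
  -- even after dropping the nonnegative `β` term.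
  have e4 : 4 * a ≤ α * (b + c) := by
    nlinarith [mul_le_mul_of_nonneg_left e3 hα0, mul_le_mul_of_nonneg_left hs2 (by linarith : 0 ≤ a)]
  have e5 : 0 ≤ β * a := by positivity
  have e6 : α * (M * (C - b)) + α * (M * (C - c)) + 2 * (β * (M * (C - a))) ≤
      2 * (M * (C - a - 1)) := by
    have : α * (M * (C - b)) + α * (M * (C - c)) + 2 * (β * (M * (C - a))) =
        M * ((α + β) * (2 * C) - α * (b + c) - 2 * (β * a)) := by ring
    rw [this, hp.add_eq_one, mul_left_comm 2 M]
    exact mul_le_mul_of_nonneg_left (by linarith) hM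
  linarith

lemma extremalSum_contraction_of_two_le (hp : Admissible ε α β) (hn : 2 ≤ n)
    (hX : MeasurableSet X) (hu : BoundedMeasurableOn X u) (hw : BoundedMeasurableOn X w)
    (hΩ : ∀ x ∈ Ω, ∀ z, ‖z‖ ≤ ε → x + z ∈ X) {s : ℝ} (hs : 0 ≤ s)
    (hs2 : 2 ≤ β * (1 + s * (ε ^ 2 / 8))) {C M : ℝ} (hM : 0 ≤ M)
    (h : ∀ y ∈ X, u y - w y ≤ M * (C - Real.exp (s * ‖y‖ ^ 2))) (hx : x ∈ Ω) :
    extremalSum ε α β u x - extremalSum ε α β w x ≤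
      2 * (M * (C - Real.exp (s * ‖x‖ ^ 2) - 1)) := by
  refine extremalSum_sub_le hp hX hu hw (hΩ x hx) (hΩ x hx)
    (sphere_nonempty (by omega) hp.step_pos.le) fun v hv => ?_
  have hv0 : v ≠ 0 := norm_ne_zero_iff.1 (hv ▸ hp.step_pos.ne')
  have := isProbabilityMeasure_diskMeasure v hp.step_pos
  have hi : Integrable (fun z => Real.exp (s * ‖x + z‖ ^ 2)) (diskMeasure ε v) :=
    integrable_diskMeasure_of_continuous hp.step_pos (by fun_prop)
  have h1 := moveValue_sub_le (f := fun z => M * (C - Real.exp (s * ‖x + z‖ ^ 2)))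
    hp.fst_nonneg hp.snd_pos.le hv
    (hu.integrable hX hp.step_pos (hΩ x hx)) (hw.integrable hX hp.step_pos (hΩ x hx))
    (integrable_diskMeasure_of_continuous hp.step_pos (by fun_prop))
    fun z hz => h _ (hΩ x hx z hz)
  refine h1.trans ?_
  rw [integral_const_mul, integral_sub (integrable_const _) hi, integral_const, probReal_univ,
    one_smul]
  have e1 := one_add_mul_exp_le_integral hn hp.step_pos hv0 hs x
  have e0 : 1 ≤ Real.exp (s * ‖x‖ ^ 2) := Real.one_le_exp (by positivity)
  have hα0 := hp.fst_nonneg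
  have e2 : 0 ≤ α * Real.exp (s * ‖x + v‖ ^ 2) := by positivity
  set a := Real.exp (s * ‖x‖ ^ 2)
  set b := Real.exp (s * ‖x + v‖ ^ 2)
  set c := ∫ z, Real.exp (s * ‖x + z‖ ^ 2) ∂(diskMeasure ε v)
  -- The disk term alone gains a factor 2; the `α` term is nonnegative and is dropped, and `a ≥ 1`
  -- turns `C - 2 * a` into at most `C - a - 1`.
  have e4 : 2 * a ≤ β * c := by
    nlinarith [mul_le_mul_of_nonneg_left e1 hp.snd_pos.le,
      mul_le_mul_of_nonneg_left hs2 (by linarith : 0 ≤ a)]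
  have : α * (M * (C - b)) + β * (M * (C - c)) = M * ((α + β) * C - α * b - β * c) := by ring
  rw [this, hp.add_eq_one]
  exact mul_le_mul_of_nonneg_left (by linarith) hM

/-- There is a weight for which the dynamic programming operator is a strict contraction. -/
lemma exists_contraction_weight (hp : Admissible ε α β) (hn : 1 ≤ n) (hα : n = 1 → 0 < α)
    (hX : IsCompact X) (hΩX : Ω ⊆ X) (hΩ : ∀ x ∈ Ω, ∀ z, ‖z‖ ≤ ε → x + z ∈ X) :
    ∃ (g : EuclideanSpace ℝ (Fin n) → ℝ) (C c : ℝ), 0 ≤ c ∧ c < 1 ∧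
      (∀ x ∈ X, 1 ≤ g x ∧ g x ≤ C) ∧
      ∀ u w, BoundedMeasurableOn X u → BoundedMeasurableOn X w → ∀ M, 0 ≤ M →
        (∀ y ∈ X, u y - w y ≤ M * g y) →
        ∀ x ∈ Ω, extremalSum ε α β u x - extremalSum ε α β w x ≤ 2 * (c * M * g x) := by
  have hε := hp.step_pos
  obtain ⟨s, hs, hs'⟩ : ∃ s : ℝ, 0 ≤ s ∧ ∀ u w, BoundedMeasurableOn X u →
      BoundedMeasurableOn X w → ∀ M, 0 ≤ M → ∀ C,
        (∀ y ∈ X, u y - w y ≤ M * (C - Real.exp (s * ‖y‖ ^ 2))) →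
        ∀ x ∈ Ω, extremalSum ε α β u x - extremalSum ε α β w x ≤
          2 * (M * (C - Real.exp (s * ‖x‖ ^ 2) - 1)) := by
    rcases hn.eq_or_lt with rfl | hn
    · obtain ⟨s, hs, hs2⟩ := exists_two_le_mul (hα rfl) (by positivity : 0 < ε ^ 2)
      exact ⟨s, hs, fun u w _ _ M hM C h x hx =>
        extremalSum_contraction_dim_one hp hΩX hΩ hs hs2 hM h hx⟩
    · obtain ⟨s, hs, hs2⟩ := exists_two_le_mul hp.snd_pos (by positivity : 0 < ε ^ 2 / 8)
      exact ⟨s, hs, fun u w hu hw M hM C h x hx =>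
        extremalSum_contraction_of_two_le hp hn hX.measurableSet hu hw hΩ hs hs2 hM h hx⟩
  obtain ⟨H, hH⟩ := hX.exists_bound_of_continuousOn (f := fun x => Real.exp (s * ‖x‖ ^ 2))
    (by fun_prop)
  have hH' : ∀ x ∈ X, Real.exp (s * ‖x‖ ^ 2) ≤ max H 0 := fun x hx =>
    (le_abs_self _).trans ((hH x hx).trans (le_max_left _ _))
  have hC : 0 ≤ max H 0 := le_max_right _ _
  -- The added 1 makes the weight at least 1 on `X`; the maximum with 0 keeps `C ≥ 1` even if `X` is
  -- empty.
  set C := max H 0 + 1 with hCdef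
  refine ⟨fun x => C - Real.exp (s * ‖x‖ ^ 2), C, 1 - C⁻¹, ?_, ?_, ?_, ?_⟩
  · exact sub_nonneg.2 (inv_le_one_of_one_le₀ (by linarith))
  · have : 0 < C⁻¹ := inv_pos.2 (by linarith)
    linarith
  · intro x hx
    exact ⟨by linarith [hH' x hx], by linarith [Real.exp_pos (s * ‖x‖ ^ 2)]⟩
  · intro u w hu hw M hM h x hx
    refine (hs' u w hu hw M hM C h x hx).trans ?_
    -- As `g ≤ C`, subtracting 1 removes at least `C⁻¹ * g`, hence the rate `1 - C⁻¹`.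
    have h1 : C⁻¹ * (C - Real.exp (s * ‖x‖ ^ 2)) ≤ 1 := by
      rw [inv_mul_le_iff₀ (by linarith)]
      linarith [Real.exp_pos (s * ‖x‖ ^ 2)]
    have h2 := mul_le_mul_of_nonneg_left h1 hM
    linarith

end TugOfWar

/-! ### The operator: continuity, contraction and fixed points. -/

namespace TugOfWar

variable {n : ℕ} {Ω : Set (EuclideanSpace ℝ (Fin n))} {ε α β : ℝ}
  {u w F : EuclideanSpace ℝ (Fin n) → ℝ} {x v : EuclideanSpace ℝ (Fin n)}

lemma dppOperator_eq (x : EuclideanSpace ℝ (Fin n)) :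
    dppOperator Ω ε α β F u x =
      (1 - cutoff Ω ε x) * (extremalSum ε α β u x / 2) + cutoff Ω ε x * F x := by
  rw [dppOperator, extremalSum]
  ring

/-- Each summand is controlled only where its cutoff factor is nonzero: the extremal sum on `Ω`, `F`
on the boundary strip. Boundedness there handles the points where the factor vanishes. -/
lemma continuousOn_dppOperator (hp : Admissible ε α β) (hn : 1 ≤ n)
    (hX : IsCompact (thickenedDomain Ω ε)) {K : NNReal}
    (hF : LipschitzOnWith K F (boundaryStrip Ω ε)) (hΓ : Bornology.IsBounded (boundaryStrip Ω ε))
    (hu : ContinuousOn u (thickenedDomain Ω ε)) :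
    ContinuousOn (dppOperator Ω ε α β F u) (thickenedDomain Ω ε) := by
  have hε := hp.step_pos
  have hne := sphere_nonempty hn hε.le
  have hΩX : ∀ x ∈ Ω, ∀ z, ‖z‖ ≤ ε → x + z ∈ thickenedDomain Ω ε :=
    fun x hx z hz => add_mem_thickenedDomain hx hz
  have hm := BoundedMeasurableOn.of_continuousOn hX hu
  obtain ⟨C, hC⟩ := hm.bounded
  obtain ⟨G, hG, hFG⟩ := hF.extend_real
  obtain ⟨D, hD⟩ := (hG.isBounded_image hΓ).exists_norm_le
  have hmem : ∀ x, 1 - cutoff Ω ε x ≠ 0 → x ∈ Ω := fun x hx => by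
    by_contra h
    exact hx (by rw [cutoff_of_notMem h, sub_self])
  have h1 : ContinuousOn (fun x => (1 - cutoff Ω ε x) * (extremalSum ε α β u x / 2))
      (thickenedDomain Ω ε) := by
    refine continuousOn_mul_of_bounded (continuous_const.sub (continuous_cutoff hε)) ?_
      (C := C) fun x _ hx => ?_
    · exact ((continuousOn_extremalSum hp hX hu hΩX hne).div_const 2).mono
        fun x hx => hmem x hx.2
    · have := abs_extremalSum_le hp hX.measurableSet hm (hΩX x (hmem x hx)) hne hC
      rw [abs_div, abs_two]
      linarith
  have h2 : ContinuousOn (fun x => cutoff Ω ε x * F x) (thickenedDomain Ω ε) := by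
    refine continuousOn_mul_of_bounded (continuous_cutoff hε)
      (hF.continuousOn.mono fun x hx => mem_boundaryStrip_of_cutoff_ne_zero hε hx.1 hx.2)
      (C := D) fun x hx hx0 => ?_
    have hxΓ := mem_boundaryStrip_of_cutoff_ne_zero hε hx hx0
    rw [hFG hxΓ]
    exact hD _ (mem_image_of_mem G hxΓ)
  exact (h1.add h2).congr fun x _ => dppOperator_eq x

/-- `T` contracts the `g`-weighted distance of functions on `X` by the factor `c`. -/
def ContractsOn (X : Set (EuclideanSpace ℝ (Fin n))) (g : EuclideanSpace ℝ (Fin n) → ℝ) (c : ℝ)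
    (T : (EuclideanSpace ℝ (Fin n) → ℝ) → EuclideanSpace ℝ (Fin n) → ℝ) : Prop :=
  ∀ u w, BoundedMeasurableOn X u → BoundedMeasurableOn X w → ∀ M, 0 ≤ M →
    (∀ y ∈ X, |u y - w y| ≤ M * g y) → ∀ y ∈ X, |T u y - T w y| ≤ c * M * g y

lemma exists_contractsOn_dppOperator (hp : Admissible ε α β) (hn : 1 ≤ n) (hα : n = 1 → 0 < α)
    (hX : IsCompact (thickenedDomain Ω ε)) (F : EuclideanSpace ℝ (Fin n) → ℝ) :
    ∃ (g : EuclideanSpace ℝ (Fin n) → ℝ) (C c : ℝ), 0 ≤ c ∧ c < 1 ∧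
      (∀ x ∈ thickenedDomain Ω ε, 1 ≤ g x ∧ g x ≤ C) ∧
      ContractsOn (thickenedDomain Ω ε) g c (dppOperator Ω ε α β F) := by
  obtain ⟨g, C, c, hc0, hc1, hg, h⟩ := exists_contraction_weight hp hn hα hX
    subset_union_left fun x hx z hz => add_mem_thickenedDomain (ε := ε) hx hz
  refine ⟨g, C, c, hc0, hc1, hg, ?_⟩
  have key : ∀ u w, BoundedMeasurableOn (thickenedDomain Ω ε) u →
      BoundedMeasurableOn (thickenedDomain Ω ε) w → ∀ M, 0 ≤ M →
      (∀ y ∈ thickenedDomain Ω ε, u y - w y ≤ M * g y) → ∀ y ∈ thickenedDomain Ω ε,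
        dppOperator Ω ε α β F u y - dppOperator Ω ε α β F w y ≤ c * M * g y := by
    intro u w hu hw M hM huw y hy
    have h0 : 0 ≤ c * M * g y :=
      mul_nonneg (mul_nonneg hc0 hM) (zero_le_one.trans (hg y hy).1)
    rw [dppOperator_eq, dppOperator_eq]
    -- In `Ω` the `F` terms cancel and `1 - δ` lies in `[0, 1]`; outside `Ω` both values are `F y`.
    by_cases hyΩ : y ∈ Ω
    · have h1 := h u w hu hw M hM huw y hyΩ
      have h2 := cutoff_nonneg (Ω := Ω) hp.step_pos y
      have h3 := cutoff_le_one (Ω := Ω) hp.step_pos y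
      nlinarith
    · rw [cutoff_of_notMem hyΩ]
      linarith
  intro u w hu hw M hM huw y hy
  rw [abs_le]
  have h1 := key u w hu hw M hM (fun z hz => (le_abs_self _).trans (huw z hz)) y hy
  have h2 := key w u hw hu M hM
    (fun z hz => (le_abs_self _).trans ((abs_sub_comm _ _).trans_le (huw z hz))) y hy
  exact ⟨by linarith, h1⟩

section FixedPoint

variable {X : Set (EuclideanSpace ℝ (Fin n))} {g : EuclideanSpace ℝ (Fin n) → ℝ} {C c : ℝ}
  {T : (EuclideanSpace ℝ (Fin n) → ℝ) → EuclideanSpace ℝ (Fin n) → ℝ}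

lemma BoundedMeasurableOn.exists_abs_sub_le {u w : EuclideanSpace ℝ (Fin n) → ℝ}
    (hu : BoundedMeasurableOn X u) (hw : BoundedMeasurableOn X w) (hg : ∀ x ∈ X, 1 ≤ g x) :
    ∃ M, 0 ≤ M ∧ ∀ y ∈ X, |u y - w y| ≤ M * g y := by
  obtain ⟨A, hA⟩ := hu.bounded
  obtain ⟨B, hB⟩ := hw.bounded
  refine ⟨|A| + |B|, by positivity, fun y hy => ?_⟩
  calc |u y - w y| ≤ |u y| + |w y| := abs_sub _ _
    _ ≤ |A| + |B| := add_le_add ((hA y hy).trans (le_abs_self _)) ((hB y hy).trans (le_abs_self _))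
    _ ≤ (|A| + |B|) * g y := le_mul_of_one_le_right (by positivity) (hg y hy)

/-- The contraction is applied only to `u` and `w` themselves, improving the constant each time, so
measurability of `T u` for a general `u` is never needed. -/
lemma ContractsOn.eqOn_of_fixed (hT : ContractsOn X g c T) (hc0 : 0 ≤ c) (hc1 : c < 1)
    (hg : ∀ x ∈ X, 1 ≤ g x) {u w : EuclideanSpace ℝ (Fin n) → ℝ} (hu : BoundedMeasurableOn X u)
    (hw : BoundedMeasurableOn X w) (hTu : EqOn u (T u) X) (hTw : EqOn w (T w) X) :
    EqOn u w X := by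
  obtain ⟨M, hM, h⟩ := hu.exists_abs_sub_le hw hg
  have hk : ∀ k : ℕ, ∀ y ∈ X, |u y - w y| ≤ c ^ k * M * g y := by
    intro k
    induction k with
    | zero => simpa using h
    | succ k ih =>
      intro y hy
      rw [hTu hy, hTw hy, pow_succ', mul_assoc c]
      exact hT u w hu hw _ (by positivity) ih y hy
  intro y hy
  have h0 : Tendsto (fun k : ℕ => c ^ k * M * g y) atTop (𝓝 0) := by
    simpa using ((tendsto_pow_atTop_nhds_zero_of_lt_one hc0 hc1).mul_const M).mul_const (g y)
  have := ge_of_tendsto' h0 fun k => hk k y hy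
  exact sub_eq_zero.1 (abs_nonpos_iff.1 this)

/-- Banach iteration on functions whose values matter only on `X`. Starting from a continuous
function keeps all iterates bounded and measurable, and `g ≤ C` makes the weighted convergence
uniform. -/
lemma ContractsOn.exists_fixed (hT : ContractsOn X g c T) (hc0 : 0 ≤ c) (hc1 : c < 1)
    (hg : ∀ x ∈ X, 1 ≤ g x ∧ g x ≤ C) (hX : IsCompact X)
    (hcont : ∀ u, ContinuousOn u X → ContinuousOn (T u) X)
    {u₀ : EuclideanSpace ℝ (Fin n) → ℝ} (hu₀ : ContinuousOn u₀ X) :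
    ∃ u : EuclideanSpace ℝ (Fin n) → ℝ, ContinuousOn u X ∧ EqOn u (T u) X ∧
      ∀ x ∈ X, Tendsto (fun k : ℕ => (T^[k] u₀) x) atTop (𝓝 (u x)) := by
  have hcont' : ∀ k : ℕ, ContinuousOn (T^[k] u₀) X := by
    intro k
    induction k with
    | zero => exact hu₀
    | succ k ih =>
      rw [Function.iterate_succ_apply']
      exact hcont _ ih
  have hbm := fun k => BoundedMeasurableOn.of_continuousOn hX (hcont' k)
  obtain ⟨M, hM, h⟩ := (hbm 0).exists_abs_sub_le (hbm 1) fun x hx => (hg x hx).1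
  have hk : ∀ k : ℕ, ∀ y ∈ X, |(T^[k] u₀) y - (T^[k + 1] u₀) y| ≤ c ^ k * M * g y := by
    intro k
    induction k with
    | zero => simpa using h
    | succ k ih =>
      intro y hy
      rw [pow_succ', mul_assoc c, Function.iterate_succ_apply' T k,
        Function.iterate_succ_apply' T (k + 1)]
      exact hT _ _ (hbm k) (hbm (k + 1)) _ (by positivity) ih y hy
  have hgeom : ∀ y ∈ X, ∀ k : ℕ,
      dist ((T^[k] u₀) y) ((T^[k + 1] u₀) y) ≤ M * g y * c ^ k := fun y hy k => by
    rw [Real.dist_eq]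
    exact (hk k y hy).trans_eq (by ring)
  have hlim : ∀ y, ∃ l, y ∈ X → Tendsto (fun k : ℕ => (T^[k] u₀) y) atTop (𝓝 l) := by
    intro y
    by_cases hy : y ∈ X
    · obtain ⟨l, hl⟩ := cauchySeq_tendsto_of_complete
        (cauchySeq_of_le_geometric c (M * g y) hc1 (hgeom y hy))
      exact ⟨l, fun _ => hl⟩
    · exact ⟨0, fun h => absurd h hy⟩
  choose u hu using hlim
  have hdist : ∀ k : ℕ, ∀ y ∈ X, |(T^[k] u₀) y - u y| ≤ M * c ^ k / (1 - c) * g y :=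
    fun k y hy => by
      rw [← Real.dist_eq]
      exact (dist_le_of_le_geometric_of_tendsto c (M * g y) hc1 (hgeom y hy) (hu y hy) k).trans_eq
        (by ring)
  have hzero : ∀ a : ℝ, Tendsto (fun k : ℕ => M * c ^ k / (1 - c) * a) atTop (𝓝 0) := fun a => by
    simpa using (((tendsto_pow_atTop_nhds_zero_of_lt_one hc0 hc1).const_mul M).div_const
      (1 - c)).mul_const a
  have hpos : ∀ k : ℕ, 0 ≤ M * c ^ k / (1 - c) := fun k =>
    div_nonneg (by positivity) (by linarith)
  have huc : ContinuousOn u X := by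
    refine TendstoUniformlyOn.continuousOn (F := fun k : ℕ => T^[k] u₀) (p := atTop) ?_
      (Frequently.of_forall hcont')
    rw [Metric.tendstoUniformlyOn_iff]
    intro η hη
    filter_upwards [(hzero C).eventually_lt_const hη] with k hk y hy
    rw [dist_comm, Real.dist_eq]
    exact ((hdist k y hy).trans (mul_le_mul_of_nonneg_left (hg y hy).2 (hpos k))).trans_lt hk
  refine ⟨u, huc, fun y hy => ?_, fun y hy => hu y hy⟩
  -- Contraction carries the convergence of the iterates to `u` over to their images, so the shifted
  -- sequence tends to `T u`.
  have h1 : Tendsto (fun k : ℕ => (T^[k + 1] u₀) y) atTop (𝓝 (T u y)) := by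
    rw [tendsto_iff_dist_tendsto_zero]
    refine squeeze_zero (fun _ => dist_nonneg) (fun k => ?_) (by simpa using (hzero (g y)).const_mul c)
    rw [Function.iterate_succ_apply', Real.dist_eq, ← mul_assoc]
    exact hT _ _ (hbm k) (.of_continuousOn hX huc) _ (hpos k) (hdist k) y hy
  exact tendsto_nhds_unique ((tendsto_add_atTop_iff_nat 1).2 (hu y hy)) h1

end FixedPoint

end TugOfWar

/-! ### Assembly of the theorem. -/

theorem mainTheorem2 (n : ℕ) (hn : 1 ≤ n)
    (Ω : Set (EuclideanSpace ℝ (Fin n))) (hΩo : IsOpen Ω) (hΩc : IsConnected Ω)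
    (hΩb : Bornology.IsBounded Ω)
    (ε : ℝ) (hε : 0 < ε)
    (α β : ℝ) (hα : 0 ≤ α) (hβ : 0 < β) (hαβ : α + β = 1) (hnα : n = 1 → 0 < α)
    (F : EuclideanSpace ℝ (Fin n) → ℝ)
    (hF : ∃ K : NNReal, LipschitzOnWith K F (TugOfWar.boundaryStrip Ω ε)) :
    ∃ uLow uUp : EuclideanSpace ℝ (Fin n) → ℝ,
      TugOfWar.IsIterationLimit Ω ε α β F (sInf (F '' TugOfWar.boundaryStrip Ω ε)) uLow ∧
      TugOfWar.IsIterationLimit Ω ε α β F (sSup (F '' TugOfWar.boundaryStrip Ω ε)) uUp ∧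
      LowerSemicontinuousOn uLow (TugOfWar.thickenedDomain Ω ε) ∧
      UpperSemicontinuousOn uUp (TugOfWar.thickenedDomain Ω ε) ∧
      TugOfWar.IsMeasurableSolution Ω ε α β F uLow ∧
      TugOfWar.IsMeasurableSolution Ω ε α β F uUp ∧
      EqOn uLow uUp (TugOfWar.thickenedDomain Ω ε) ∧
      ∀ u : EuclideanSpace ℝ (Fin n) → ℝ, TugOfWar.IsMeasurableSolution Ω ε α β F u →
        EqOn u uLow (TugOfWar.thickenedDomain Ω ε) ∧
        ContinuousOn u (TugOfWar.thickenedDomain Ω ε) := by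

  have hp : TugOfWar.Admissible ε α β := ⟨hε, hα, hβ, hαβ⟩
  obtain ⟨K, hF⟩ := hF
  have hX : IsCompact (TugOfWar.thickenedDomain Ω ε) := TugOfWar.isCompact_thickenedDomain hε.le
    (TugOfWar.frontier_nonempty_of_isBounded hn hΩc.nonempty hΩb) hΩb
  obtain ⟨g, C, c, hc0, hc1, hg, hT⟩ :=
    TugOfWar.exists_contractsOn_dppOperator hp hn hnα hX F
  have hcont : ∀ u, ContinuousOn u (TugOfWar.thickenedDomain Ω ε) →
      ContinuousOn (TugOfWar.dppOperator Ω ε α β F u) (TugOfWar.thickenedDomain Ω ε) :=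
    fun u hu => TugOfWar.continuousOn_dppOperator hp hn hX hF (hX.isBounded.subset fun x hx => hx.1)
      hu
  -- Any starting constant works; monotonicity of the iterates plays no role.
  have hex := fun a : ℝ => hT.exists_fixed hc0 hc1 hg hX hcont (u₀ := fun _ => a)
    continuousOn_const
  obtain ⟨uLow, hLc, hLfix, hLlim⟩ := hex (sInf (F '' TugOfWar.boundaryStrip Ω ε))
  obtain ⟨uUp, hUc, hUfix, hUlim⟩ := hex (sSup (F '' TugOfWar.boundaryStrip Ω ε))
  have hL := TugOfWar.BoundedMeasurableOn.of_continuousOn hX hLc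
  have hU := TugOfWar.BoundedMeasurableOn.of_continuousOn hX hUc
  have huniq : ∀ u, TugOfWar.BoundedMeasurableOn (TugOfWar.thickenedDomain Ω ε) u →
      EqOn u (TugOfWar.dppOperator Ω ε α β F u) (TugOfWar.thickenedDomain Ω ε) →
      EqOn u uLow (TugOfWar.thickenedDomain Ω ε) := fun u hu hfix =>
    hT.eqOn_of_fixed hc0 hc1 (fun x hx => (hg x hx).1) hu hL hfix hLfix
  -- Both limits are continuous, which gives the two semicontinuity claims.
  refine ⟨uLow, uUp, hLlim, hUlim, hLc.lowerSemicontinuousOn, hUc.upperSemicontinuousOn,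
    ⟨hL.measurable, hL.bounded, hLfix⟩, ⟨hU.measurable, hU.bounded, hUfix⟩,
    (huniq uUp hU hUfix).symm, fun u hu => ?_⟩
  have h := huniq u ⟨hu.measurable, hu.bounded⟩ hu.dpp
  exact ⟨h, hLc.congr h⟩
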